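/- Conventions. For integers $n,M$, inputs $x\in[M]^n$ are regarded as functions $x:[n]\to[M]$. A quantum query algorithm $\mathscr A^{\mathscr O}$ with oracle $\mathscr O_g:|i\rangle|j\rangle\mapsto|i\rangle|j+g(i)\rangle$ (addition modulo $M$), for $g:[n]\to[M]$, starts in a fixed basis state of an index register, a value register and a finite work register, applies finitely many fixed unitaries and oracle calls, and outputs one bit read off from a final measurement in the computational basis. For $S\subseteq[M]^n$ and $f:S\to\{0,1\}$, $Q(f)$ is the smallest $q$ such that some quantum algorithm performing $q$ queries satisfies $\Pr[\mathscr A^{\mathscr O_x}\text{ outputs }f(x)]\ge 2/3$ for all $x\in S$; such an algorithm with $q=Q(f)$ queries is called optimal. $f$ is permutation symmetric (of the first type) if $x\circ\pi\in S$ and $f(x\circ\pi)=f(x)$ for all $x\in S$ and all permutations $\pi$ of $[n]$. For $1\le r\le n$, $D_r$ is the distribution of $h\circ g:[n]\to[n]$, where $g:[n]\to[r]$ is uniformly random and $h:[r]\to[n]$ is an independent uniformly random injection; $D_{\mathrm{perm}}$ is the uniform distribution on the permutations of $[n]$. Call $\Lambda>0$ a small-range constant if for all $1\le r\le n$ and every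 quantum query algorithm $\mathscr B$ performing at most $\Lambda r^{1/3}$ queries to an oracle $[n]\to[n]$, $$\forall b\in\{0,1\},\quad \Bigl|\mathbb E_{\pi\leftarrow D_{\mathrm{perm}}}\Pr[\mathscr B^{\mathscr O_\pi}\text{ outputs }b]-\mathbb E_{C\leftarrow D_r}\Pr[\mathscr B^{\mathscr O_C}\text{ outputs }b]\Bigr|\le\tfrac{2}{27}.$$ Proposition 3. An absolute small-range constant $\Lambda>0$ exists. Moreover, let $\Lambda>0$ be any small-range constant, let $f:S\to\{0,1\}$ with $S\subseteq[M]^n$ be permutation symmetric of the first type, let $q=Q(f)$ and $r=\lceil 216\,q^3\Lambda^{-3}\rceil$, and assume $1\le r\le n$. Let $\mathscr A$ be any optimal quantum algorithm for $f$, and let $\mathscr A_3$ be the algorithm that runs $\mathscr A$ independently three times and outputs the majority of the three output bits. Then $\mathscr A_3$ performs $3q$ queries, and $$\forall x\in S,\quad \mathbb E_{C\leftarrow D_r}\Pr[\mathscr A_3^{\mathscr O_{x\circ C}}\text{ outputs }f(x)]\ge 2/3 .$$ Moreover, every $C$ in the support of $D_r$ satisfies $|\mathrm{Im}(C)|\le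 r$, and the output distribution of $\mathscr A_3^{\mathscr O_{x\circ C}}$ depends only on the restriction of $x$ to $\mathrm{Im}(C)$. -/

import Mathlib

open scoped BigOperators Kronecker

/-- An elementary step of a quantum query algorithm whose computational basis is `K`: either a
fixed unitary, which does not depend on the oracle, or one call to the oracle. -/
inductive QGate (K : Type) [Fintype K] [DecidableEq K] : Type
  | unitary (U : Matrix.unitaryGroup K ℂ) : QGate K
  | query : QGate K

namespace QGate

/-- Effect of one step on a state vector `ψ`, when the oracle is the unitary
`|i⟩|j⟩|w⟩ ↦ |i⟩|j + g i⟩|w⟩` (addition modulo `M`).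
The amplitude of `|i⟩|j⟩|w⟩` after a query is the one of `|i⟩|j - g i⟩|w⟩` before it. -/
def apply {n M : ℕ} {W : Type} [Fintype W] [DecidableEq W] (g : Fin n → Fin M)
    (ψ : Fin n × Fin M × W → ℂ) : QGate (Fin n × Fin M × W) → (Fin n × Fin M × W → ℂ)
  | unitary U => (U : Matrix (Fin n × Fin M × W) (Fin n × Fin M × W) ℂ).mulVec ψ
  | query => fun k => ψ (k.1, k.2.1 - g k.1, k.2.2)

/-- `true` exactly for an oracle call. -/
def isQuery {K : Type} [Fintype K] [DecidableEq K] : QGate K → Bool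
  | unitary _ => false
  | query => true

end QGate

/-- A quantum query algorithm with one output bit, for oracles `[n] → [M]`. It has an index
register, a value register, and a finite work register; it starts in a basis state, performs a
finite sequence of unitaries and oracle calls, measures all registers in the computational basis
and outputs a bit depending on the measured basis state. -/
structure QueryAlg (n M : ℕ) : Type 1 where
  /-- basis of the work register -/
  Work : Type
  [fintypeWork : Fintype Work]
  [decEqWork : DecidableEq Work]
  /-- initial basis state -/
  init : Fin n × Fin M × Work
  /-- the steps, in the order in which they are performed -/
  gates : List (QGate (Fin n × Fin M × Work))
  /-- the output bit for each measured basis state -/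
  out : Fin n × Fin M × Work → Bool

attribute [instance] QueryAlg.fintypeWork QueryAlg.decEqWork

namespace QueryAlg

variable {n M : ℕ}

/-- The computational basis of the algorithm. -/
abbrev Basis (A : QueryAlg n M) : Type := Fin n × Fin M × A.Work

/-- Number of oracle calls. -/
def queries (A : QueryAlg n M) : ℕ := A.gates.countP QGate.isQuery

/-- Final state of the algorithm when its oracle is that of `g`. -/
def finalState (A : QueryAlg n M) (g : Fin n → Fin M) : A.Basis → ℂ :=
  A.gates.foldl (QGate.apply g) (Pi.single A.init 1)

/-- The probability that the algorithm, run with the oracle of `g`, outputs `b`. -/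
noncomputable def outputProb (A : QueryAlg n M) (g : Fin n → Fin M) (b : Bool) : ℝ :=
  ∑ k : A.Basis, if A.out k = b then ‖A.finalState g k‖ ^ 2 else 0

/-- `A` computes the partial function `f` with success probability at least `2 / 3`. -/
def Computes (A : QueryAlg n M) {S : Set (Fin n → Fin M)} (f : S → Bool) : Prop :=
  ∀ x : S, 2 / 3 ≤ A.outputProb x (f x)

end QueryAlg

/-- The quantum query complexity `Q(f)`. -/
noncomputable def quantumQueryComplexity {n M : ℕ} {S : Set (Fin n → Fin M)} (f : S → Bool) : ℕ :=
  sInf {q : ℕ | ∃ A : QueryAlg n M, A.queries = q ∧ A.Computes f}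

/-- `f` is permutation symmetric (of the first type): its domain `S` is stable under permutations
of the `n` positions, and so is the value of `f`. -/
def PermSymmetric {n M : ℕ} {S : Set (Fin n → Fin M)} (f : S → Bool) : Prop :=
  ∀ (x : S) (π : Equiv.Perm (Fin n)),
    ∃ h : (x : Fin n → Fin M) ∘ π ∈ S, f ⟨(x : Fin n → Fin M) ∘ π, h⟩ = f x

/-! Three-fold majority amplification. -/

/-- The unitary that permutes the computational basis by `σ`. -/
def permUnitary {K : Type} [Fintype K] [DecidableEq K] (σ : Equiv.Perm K) :
    Matrix.unitaryGroup K ℂ :=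
  ⟨σ.permMatrix ℂ, by
    rw [Matrix.mem_unitaryGroup_iff, Matrix.star_eq_conjTranspose, Matrix.conjTranspose_permMatrix,
      ← Matrix.permMatrix_mul]
    simp⟩

namespace QueryAlg

variable {n M : ℕ}

/-- Work register for three runs: the registers of the active run together with
all the registers of the two inactive runs. -/
abbrev Work3 (A : QueryAlg n M) : Type := A.Work × A.Basis × A.Basis

instance (A : QueryAlg n M) : DecidableEq A.Basis := instDecidableEqProd

instance (A : QueryAlg n M) : DecidableEq A.Work3 := instDecidableEqProd

/-- The registers of three runs, the active one first, which holds the query registers. -/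
def splitRuns (A : QueryAlg n M) :
    A.Basis × (A.Basis × A.Basis) ≃ Fin n × Fin M × A.Work3 where
  toFun k := (k.1.1, k.1.2.1, k.1.2.2, k.2)
  invFun k := ((k.1, k.2.1, k.2.2.1), k.2.2.2)
  left_inv _ := rfl
  right_inv _ := rfl

/-- A step of `A` performed on the active run, with the identity on the inactive ones. -/
def liftGate (A : QueryAlg n M) : QGate A.Basis → QGate (Fin n × Fin M × A.Work3)
  | .unitary U => .unitary
      ⟨Matrix.reindex A.splitRuns A.splitRuns
        ((U : Matrix A.Basis A.Basis ℂ) ⊗ₖ (1 : Matrix (A.Basis × A.Basis) _ ℂ)), by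
        have h := Matrix.kronecker_mem_unitary U.2
          (one_mem (Matrix.unitaryGroup (A.Basis × A.Basis) ℂ))
        rw [Matrix.mem_unitaryGroup_iff, Matrix.star_eq_conjTranspose] at h ⊢
        rw [Matrix.conjTranspose_reindex, Matrix.reindex_apply, Matrix.reindex_apply,
          Matrix.submatrix_mul_equiv, h, Matrix.submatrix_one_equiv]⟩
  | .query => .query

/-- The cyclic exchange of the three runs: `(k₁, k₂, k₃) ↦ (k₂, k₃, k₁)`. -/
def cycleRuns (A : QueryAlg n M) : Equiv.Perm (Fin n × Fin M × A.Work3) :=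
  A.splitRuns.permCongr
    { toFun := fun k => (k.2.1, k.2.2, k.1)
      invFun := fun k => (k.2.2, k.1, k.2.1)
      left_inv := fun _ => rfl
      right_inv := fun _ => rfl }

/-- One complete run of `A` on the active registers, followed by the cyclic exchange. -/
def stage (A : QueryAlg n M) : List (QGate (Fin n × Fin M × A.Work3)) :=
  A.gates.map A.liftGate ++ [.unitary (permUnitary A.cycleRuns)]

/-- The bit that occurs most often among three bits. -/
def majority (a b c : Bool) : Bool := (a && b) || (a && c) || (b && c)

/-- Three-fold majority amplification: run `A` three times independently (each run on fresh
registers of its own) and output the majority of the three output bits. -/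
def amplify3 (A : QueryAlg n M) : QueryAlg n M where
  Work := A.Work3
  init := A.splitRuns (A.init, A.init, A.init)
  gates := A.stage ++ A.stage ++ A.stage
  out k :=
    let t := A.splitRuns.symm k
    majority (A.out t.1) (A.out t.2.1) (A.out t.2.2)

end QueryAlg

/-- Expectation of `F C` for `C` drawn from the small-range distribution `D_r` on functions
`[n] → [n]` (`1 ≤ r ≤ n`): `C = h ∘ g` for a uniformly random function `g : [n] → [r]` and an
independent uniformly random injective function `h : [r] → [n]`. -/
noncomputable def smallRangeExpect (n r : ℕ) (F : (Fin n → Fin n) → ℝ) : ℝ :=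
  𝔼 g : Fin n → Fin r, 𝔼 h : Fin r ↪ Fin n, F (h ∘ g)

/-- `Λ` is an admissible constant in the quantum lower bound for telling a uniformly random
permutation of `[n]` from a function drawn from `D_r`: no algorithm making at most `Λ r^{1/3}`
queries has advantage more than `2 / 27`. -/
def IsSmallRangeConstant (Λ : ℝ) : Prop :=
  ∀ n r : ℕ, 1 ≤ r → r ≤ n → ∀ B : QueryAlg n n, (B.queries : ℝ) ≤ Λ * (r : ℝ) ^ (1 / 3 : ℝ) →
    ∀ b : Bool, |(𝔼 π : Equiv.Perm (Fin n), B.outputProb π b) -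
      smallRangeExpect n r (fun C => B.outputProb C b)| ≤ 2 / 27

/-!
The small-range constant is found by the polynomial method. After `q` queries every amplitude is a
sum of functions of the oracle `C` that depend on at most `q` of its values, so an output
probability is a sum of functions that depend on at most `2 q` values
(`QueryAlg.exists_outputProb_mem_juntaSpan`). For `C = h ∘ g` drawn from `D_r`, relabelling the
values of `C` by a permutation does not change the distribution, so the mean of a function of the
values of `C` on a set `T` depends only on the pattern of coincidences of `g` on `T`. A pattern
with `m` classes has probability `r (r - 1) ⋯ (r - m + 1) / r ^ |T|`, a polynomial in `1 / r` of
degree at most `|T|`; at `0` it is `1` for the pattern without coincidences and `0` for all others.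
Hence the mean output probability is `P (1 / r)` for one polynomial `P` of degree at most `2 q`
and all `1 ≤ r ≤ n`, while `P 0` is the mean over permutations (`exists_poly_of_mem_juntaSpan`).

All these values lie in `[0, 1]`. Interpolating `P` at `0` and at the `d = 2 q` points
`1 / ⌊4 d ^ 3 / j ^ 2⌋`, `1 ≤ j ≤ d`, gives `|P (1 / r) - P 0| ≤ 16 d ^ 3 / r`
(`abs_eval_inv_sub_eval_zero_le`): without the rounding, the Lagrange weights of the nodes `j ^ 2`
are explicit quotients of factorials with Gaussian decay in `j`, and this decay absorbs the effect
of the rounding. So `1 / 12` is a small-range constant.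

For the second part, three runs of the algorithm end in a product state, so an error probability
of at most `1 / 3` becomes at most `7 / 27` (`QueryAlg.outputProb_amplify3`). By symmetry this
success probability `20 / 27` holds for `x ∘ π` for every permutation `π`. A query to `x ∘ π` is
simulated by two queries to `π` (`QueryAlg.outputProb_simulate`), so the amplified algorithm for
`x ∘ π` is an algorithm with `6 q ≤ Λ r ^ (1 / 3)` queries to `π`, and replacing `π` by `C` costs
at most `2 / 27`.
-/

/-! ### Polynomials bounded at the reciprocals of integers -/

/-- The modulus at `0` of the Lagrange basis polynomial of the node `j ^ 2` among the nodes
`1, 4, …, d ^ 2`. -/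
theorem prod_sq_div_abs_sq_sub_sq {j d : ℕ} (hj : 1 ≤ j) (hjd : j ≤ d) :
    ∏ i ∈ (Finset.Icc 1 d).erase j, ((i : ℝ) ^ 2 / |(i : ℝ) ^ 2 - (j : ℝ) ^ 2|) =
      2 * (d.factorial : ℝ) ^ 2 / ((d - j).factorial * (d + j).factorial) := by
  induction d, hjd using Nat.le_induction with
  | base =>
    obtain ⟨m, rfl⟩ : ∃ m, j = m + 1 := ⟨j - 1, by omega⟩
    have hset : (Finset.Icc 1 (m + 1)).erase (m + 1) = (Finset.range m).image (· + 1) := by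
      ext i
      simp only [Finset.mem_erase, Finset.mem_Icc, Finset.mem_image, Finset.mem_range]
      constructor
      · intro h
        exact ⟨i - 1, by omega, by omega⟩
      · rintro ⟨a, h, rfl⟩
        omega
    rw [hset, Finset.prod_image (by simp)]
    have hterm : ∀ i ∈ Finset.range m,
        (((i + 1 : ℕ) : ℝ) ^ 2 / |((i + 1 : ℕ) : ℝ) ^ 2 - ((m + 1 : ℕ) : ℝ) ^ 2|) =
          ((i + 1 : ℕ) : ℝ) ^ 2 / (((m - i : ℕ) : ℝ) * ((m + 2 + i : ℕ) : ℝ)) := by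
      intro i hi
      have hi' : (i : ℝ) < m := by exact_mod_cast Finset.mem_range.1 hi
      rw [abs_of_neg (by push_cast; nlinarith), Nat.cast_sub (Finset.mem_range.1 hi).le]
      push_cast
      congr 1
      ring
    rw [Finset.prod_congr rfl hterm, Finset.prod_div_distrib, Finset.prod_pow,
      Finset.prod_mul_distrib, ← Nat.cast_prod, ← Nat.cast_prod, ← Nat.cast_prod,
      Finset.prod_range_add_one_eq_factorial, ← Nat.descFactorial_eq_prod_range,
      ← Nat.ascFactorial_eq_prod_range, Nat.descFactorial_self]
    have h1 := Nat.factorial_mul_ascFactorial (m + 1) m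
    have h1' : ((m + 1).factorial : ℝ) * ((m + 1 + 1).ascFactorial m : ℝ)
        = ((m + 1 + m).factorial : ℝ) := by exact_mod_cast h1
    have h2 : ((m + 1 + (m + 1)).factorial : ℝ)
        = (2 * (m + 1)) * ((m + 1).factorial * (m + 2).ascFactorial m) := by
      rw [h1', show m + 1 + (m + 1) = (m + 1 + m) + 1 by ring, Nat.factorial_succ]
      push_cast
      ring
    have h3 : ((m + 1).factorial : ℝ) = (m + 1) * m.factorial := by
      rw [Nat.factorial_succ]; push_cast; ring
    have h4 : (0 : ℝ) < m.factorial := by exact_mod_cast Nat.factorial_pos m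
    have h5 : (0 : ℝ) < (m + 2).ascFactorial m := by
      exact_mod_cast Nat.ascFactorial_pos (m + 1) m
    rw [h2, h3]
    simp only [Nat.sub_self, Nat.factorial_zero, Nat.cast_one]
    field_simp
  | succ d hjd ih =>
    have hset : (Finset.Icc 1 (d + 1)).erase j = insert (d + 1) ((Finset.Icc 1 d).erase j) := by
      ext i
      simp only [Finset.mem_erase, Finset.mem_Icc, Finset.mem_insert]
      omega
    rw [hset, Finset.prod_insert (by simp), ih]
    have hjd' : (j : ℝ) ≤ d := by exact_mod_cast hjd
    have hj' : (1 : ℝ) ≤ j := by exact_mod_cast hj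
    rw [abs_of_pos (by push_cast; nlinarith), show d + 1 - j = (d - j) + 1 by omega,
      show d + 1 + j = (d + j) + 1 by ring, Nat.factorial_succ, Nat.factorial_succ,
      Nat.factorial_succ]
    push_cast [hjd]
    have h1 : (d : ℝ) - j + 1 ≠ 0 := by linarith
    have h2 : (d : ℝ) + j + 1 ≠ 0 := by linarith
    have h3 : ((d : ℝ) + 1) ^ 2 - j ^ 2 ≠ 0 := by nlinarith
    have h4 : ((d - j).factorial : ℝ) ≠ 0 := by exact_mod_cast Nat.factorial_ne_zero _
    have h5 : ((d + j).factorial : ℝ) ≠ 0 := by exact_mod_cast Nat.factorial_ne_zero _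
    have h6 : ((d : ℝ) + 1) ^ 2 - j ^ 2 = (d - j + 1) * (d + j + 1) := by ring
    rw [h6]
    field_simp

/-- The weights decay at least as fast as a Gaussian of variance `d`. -/
theorem factorial_sq_div_le_exp {j d : ℕ} (hj : 1 ≤ j) (hjd : j ≤ d) :
    (d.factorial : ℝ) ^ 2 / ((d - j).factorial * (d + j).factorial) ≤
      Real.exp (-((j : ℝ) ^ 2 / (2 * d))) := by
  have hd : (0 : ℝ) < d := by exact_mod_cast (by omega : 0 < d)
  have h1 : (((d - j).factorial : ℝ) * d.descFactorial j) = d.factorial := by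
    exact_mod_cast Nat.factorial_mul_descFactorial hjd
  have h2 : ((d.factorial : ℝ) * (d + 1).ascFactorial j) = (d + j).factorial := by
    exact_mod_cast Nat.factorial_mul_ascFactorial d j
  have h3 : (0 : ℝ) < (d - j).factorial := by exact_mod_cast Nat.factorial_pos _
  have h4 : (0 : ℝ) < d.factorial := by exact_mod_cast Nat.factorial_pos _
  have h5 : (0 : ℝ) < (d + 1).ascFactorial j := by exact_mod_cast Nat.ascFactorial_pos d j
  have h6 : (d.factorial : ℝ) ^ 2 / ((d - j).factorial * (d + j).factorial) =
      (d.descFactorial j : ℝ) / (d + 1).ascFactorial j := by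
    rw [← h2, div_eq_div_iff (by positivity) (by positivity)]
    calc (d.factorial : ℝ) ^ 2 * (d + 1).ascFactorial j
        = (((d - j).factorial : ℝ) * d.descFactorial j) * d.factorial *
          (d + 1).ascFactorial j := by rw [h1]; ring
      _ = _ := by ring
  rw [h6, Nat.descFactorial_eq_prod_range, Nat.ascFactorial_eq_prod_range, Nat.cast_prod,
    Nat.cast_prod, ← Finset.prod_div_distrib]
  have h7 : -((j : ℝ) ^ 2 / (2 * d)) = ∑ t ∈ Finset.range j, -((2 * (t : ℝ) + 1) / (2 * d)) := by
    rw [Finset.sum_neg_distrib, ← Finset.sum_div]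
    congr 2
    clear hj hjd h1 h2 h3 h5 h6
    induction j with
    | zero => simp
    | succ j ih => rw [Finset.sum_range_succ, ← ih]; push_cast; ring
  rw [h7, Real.exp_sum]
  refine Finset.prod_le_prod (fun _ _ => by positivity) fun t ht => ?_
  have ht' : t < j := Finset.mem_range.1 ht
  have ht'' : (t : ℝ) + 1 ≤ d := by exact_mod_cast (by omega : t + 1 ≤ d)
  rw [Nat.cast_sub (by omega)]
  push_cast
  calc ((d : ℝ) - t) / (d + 1 + t) = -((2 * t + 1) / (d + 1 + t)) + 1 := by
        field_simp; ring
    _ ≤ -((2 * (t : ℝ) + 1) / (2 * d)) + 1 := by gcongr; linarith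
    _ ≤ _ := Real.add_one_le_exp _

theorem prod_sq_div_abs_sq_sub_sq_le {j d : ℕ} (hj : 1 ≤ j) (hjd : j ≤ d) :
    ∏ i ∈ (Finset.Icc 1 d).erase j, ((i : ℝ) ^ 2 / |(i : ℝ) ^ 2 - (j : ℝ) ^ 2|) ≤
      2 * Real.exp (-((j : ℝ) ^ 2 / (2 * d))) := by
  rw [prod_sq_div_abs_sq_sub_sq hj hjd, mul_div_assoc]
  gcongr
  exact factorial_sq_div_le_exp hj hjd

theorem sum_Icc_one_div_sq_le (d : ℕ) (hd : 1 ≤ d) :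
    ∑ j ∈ Finset.Icc 1 d, 1 / (j : ℝ) ^ 2 ≤ 2 := by
  suffices h : ∑ j ∈ Finset.Icc 1 d, 1 / (j : ℝ) ^ 2 ≤ 2 - 1 / (d : ℝ) by
    have : (0 : ℝ) ≤ 1 / d := by positivity
    linarith
  induction d, hd using Nat.le_induction with
  | base => norm_num
  | succ d hd ih =>
    rw [Finset.sum_Icc_succ_top (by omega)]
    have hd' : (0 : ℝ) < d := by exact_mod_cast hd
    have : (1 : ℝ) / ((d + 1 : ℕ) : ℝ) ^ 2 ≤ 1 / d - 1 / ((d + 1 : ℕ) : ℝ) := by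
      push_cast
      rw [div_sub_div _ _ hd'.ne' (by positivity), div_le_div_iff₀ (by positivity) (by positivity)]
      nlinarith
    linarith

theorem cast_four_mul_cube_div_sq_le (d a : ℕ) :
    ((4 * d ^ 3 / a ^ 2 : ℕ) : ℝ) ≤ 4 * d ^ 3 / (a : ℝ) ^ 2 := by
  have := @Nat.cast_div_le ℝ _ _ _ (4 * d ^ 3) (a ^ 2)
  push_cast at this ⊢
  exact this

/-- Rounding the numbers `4 d ^ 3 / i ^ 2` down to integers costs little, because consecutive ones
are far apart. -/
theorem four_mul_cube_div_sq_ratio_le {i j d : ℕ} (hi : 1 ≤ i) (hid : i ≤ d) (hj : 1 ≤ j)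
    (hjd : j ≤ d) (hij : i ≠ j) :
    0 < |((4 * d ^ 3 / j ^ 2 : ℕ) : ℝ) - ((4 * d ^ 3 / i ^ 2 : ℕ) : ℝ)| ∧
    ((4 * d ^ 3 / j ^ 2 : ℕ) : ℝ) /
        |((4 * d ^ 3 / j ^ 2 : ℕ) : ℝ) - ((4 * d ^ 3 / i ^ 2 : ℕ) : ℝ)| ≤
      ((i : ℝ) ^ 2 / |(i : ℝ) ^ 2 - (j : ℝ) ^ 2|) * Real.exp ((j : ℝ) ^ 2 / (2 * d ^ 2)) := by
  have hi0 : (1 : ℝ) ≤ i := by exact_mod_cast hi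
  have hj0 : (1 : ℝ) ≤ j := by exact_mod_cast hj
  have hid' : (i : ℝ) ≤ d := by exact_mod_cast hid
  have hjd' : (j : ℝ) ≤ d := by exact_mod_cast hjd
  have hd : (0 : ℝ) < d := by linarith
  have floor_bounds : ∀ a : ℕ, 1 ≤ a → ((4 * d ^ 3 / a ^ 2 : ℕ) : ℝ) ≤ 4 * d ^ 3 / (a : ℝ) ^ 2 ∧
      4 * d ^ 3 / (a : ℝ) ^ 2 < ((4 * d ^ 3 / a ^ 2 : ℕ) : ℝ) + 1 := by
    intro a ha
    have ha' : (0 : ℝ) < (a : ℝ) ^ 2 := by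
      have : (0 : ℝ) < a := by exact_mod_cast ha
      positivity
    constructor
    · exact cast_four_mul_cube_div_sq_le d a
    · rw [div_lt_iff₀ ha']
      have : 4 * d ^ 3 < (4 * d ^ 3 / a ^ 2 + 1) * a ^ 2 := by
        have := Nat.lt_mul_div_succ (4 * d ^ 3) (show 0 < a ^ 2 by positivity)
        linarith [this, mul_comm (a ^ 2) (4 * d ^ 3 / a ^ 2 + 1)]
      exact_mod_cast this
  obtain ⟨hi1, hi2⟩ := floor_bounds i hi
  obtain ⟨hj1, hj2⟩ := floor_bounds j hj
  set si : ℝ := ((4 * d ^ 3 / i ^ 2 : ℕ) : ℝ)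
  set sj : ℝ := ((4 * d ^ 3 / j ^ 2 : ℕ) : ℝ)
  set Δ : ℝ := |(i : ℝ) ^ 2 - (j : ℝ) ^ 2| with hΔdef
  have hΔ : (i : ℝ) + j ≤ Δ := by
    have h1 : (1 : ℝ) ≤ |(i : ℝ) - j| := by
      have : (1 : ℤ) ≤ |(i : ℤ) - j| := Int.one_le_abs (by omega)
      exact_mod_cast this
    have h2 : Δ = |(i : ℝ) - j| * (i + j) := by
      rw [hΔdef, show (i : ℝ) ^ 2 - (j : ℝ) ^ 2 = (i - j) * (i + j) by ring, abs_mul,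
        abs_of_pos (show (0 : ℝ) < (i : ℝ) + j by linarith)]
    rw [h2]
    nlinarith
  have hΔ0 : 0 < Δ := by linarith
  -- `D` is the distance before rounding
  set D : ℝ := 4 * d ^ 3 / (i : ℝ) ^ 2 / (j : ℝ) ^ 2 * Δ with hD
  have hD0 : 0 < D := by positivity
  have hDabs : |4 * (d : ℝ) ^ 3 / (j : ℝ) ^ 2 - 4 * (d : ℝ) ^ 3 / (i : ℝ) ^ 2| = D := by
    rw [show 4 * (d : ℝ) ^ 3 / (j : ℝ) ^ 2 - 4 * (d : ℝ) ^ 3 / (i : ℝ) ^ 2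
      = 4 * d ^ 3 / (i : ℝ) ^ 2 / (j : ℝ) ^ 2 * ((i : ℝ) ^ 2 - (j : ℝ) ^ 2) by
        field_simp, abs_mul, abs_of_pos (by positivity)]
  have hε : 1 / D ≤ (j : ℝ) ^ 2 / (4 * d ^ 2) := by
    have h1 : 4 * (d : ℝ) ^ 2 / (j : ℝ) ^ 2 ≤ D := by
      have h2 : D = 4 * (d : ℝ) ^ 2 / (j : ℝ) ^ 2 * (d * Δ / (i : ℝ) ^ 2) := by
        rw [hD]; field_simp
      have h3 : 1 ≤ d * Δ / (i : ℝ) ^ 2 := by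
        rw [le_div_iff₀ (by positivity)]
        nlinarith
      rw [h2]
      exact le_mul_of_one_le_right (by positivity) h3
    calc 1 / D ≤ 1 / (4 * (d : ℝ) ^ 2 / (j : ℝ) ^ 2) := by gcongr
      _ = _ := by field_simp
  have hε4 : 1 / D ≤ 1 / 4 := hε.trans (by
    rw [div_le_div_iff₀ (by positivity) (by positivity)]; nlinarith)
  have hD4 : 4 ≤ D := by
    rw [div_le_div_iff₀ hD0 (by norm_num)] at hε4; linarith
  have hsep : D - 1 ≤ |sj - si| := by
    rw [← hDabs]
    rcases abs_cases (4 * (d : ℝ) ^ 3 / (j : ℝ) ^ 2 - 4 * (d : ℝ) ^ 3 / (i : ℝ) ^ 2) with h | h <;>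
    rcases abs_cases (sj - si) with h' | h' <;> linarith
  refine ⟨by linarith, ?_⟩
  have hinv : 1 / (1 - 1 / D) ≤ Real.exp ((j : ℝ) ^ 2 / (2 * d ^ 2)) := by
    have h1 : 1 / (1 - 1 / D) ≤ 2 * (1 / D) + 1 := by
      rw [div_le_iff₀ (by linarith)]
      have : 0 < 1 / D := by positivity
      nlinarith
    refine h1.trans ((Real.add_one_le_exp _).trans (Real.exp_le_exp.2 ?_))
    calc 2 * (1 / D) ≤ 2 * ((j : ℝ) ^ 2 / (4 * d ^ 2)) := by gcongr
      _ = _ := by field_simp; norm_num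
  calc sj / |sj - si| ≤ (4 * d ^ 3 / (j : ℝ) ^ 2) / (D - 1) :=
        div_le_div₀ (by positivity) hj1 (by linarith) hsep
    _ = (4 * d ^ 3 / (j : ℝ) ^ 2) / D * (1 / (1 - 1 / D)) := by
        have : D - 1 ≠ 0 := by linarith
        field_simp
    _ = ((i : ℝ) ^ 2 / Δ) * (1 / (1 - 1 / D)) := by
        congr 1
        rw [hD]
        field_simp
    _ ≤ _ := by gcongr

/-- The factor `exp (j ^ 2 / (2 d))` lost by rounding is exactly compensated by the Gaussian decay
of the unrounded product. -/
theorem prod_four_mul_cube_div_sq_ratio_le {j d : ℕ} (hj : 1 ≤ j) (hjd : j ≤ d) :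
    ∏ i ∈ (Finset.Icc 1 d).erase j, ((4 * d ^ 3 / j ^ 2 : ℕ) : ℝ) /
        |((4 * d ^ 3 / j ^ 2 : ℕ) : ℝ) - ((4 * d ^ 3 / i ^ 2 : ℕ) : ℝ)| ≤ 2 := by
  have hd : (0 : ℝ) < d := by exact_mod_cast (by omega : 0 < d)
  calc _ ≤ ∏ i ∈ (Finset.Icc 1 d).erase j, ((i : ℝ) ^ 2 / |(i : ℝ) ^ 2 - (j : ℝ) ^ 2|) *
        Real.exp ((j : ℝ) ^ 2 / (2 * d ^ 2)) := by
        refine Finset.prod_le_prod (fun _ _ => by positivity) fun i hi => ?_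
        rw [Finset.mem_erase, Finset.mem_Icc] at hi
        exact (four_mul_cube_div_sq_ratio_le hi.2.1 hi.2.2 hj hjd hi.1).2
    _ ≤ 2 * Real.exp (-((j : ℝ) ^ 2 / (2 * d))) * Real.exp ((j : ℝ) ^ 2 / (2 * d)) := by
        rw [Finset.prod_mul_distrib, Finset.prod_const]
        refine mul_le_mul (prod_sq_div_abs_sq_sub_sq_le hj hjd) ?_ (by positivity) (by positivity)
        rw [← Real.exp_nat_mul, Real.exp_le_exp]
        calc _ ≤ (d : ℝ) * ((j : ℝ) ^ 2 / (2 * d ^ 2)) := by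
              gcongr
              exact (Finset.card_le_card (Finset.erase_subset _ _)).trans (by simp)
          _ = _ := by field_simp
    _ = 2 := by rw [mul_assoc, ← Real.exp_add]; simp

/-- The nodes of the interpolation: `0` for `j = 0` (division by zero), and reciprocals of
integers close to the rescaled squares `j ^ 2 / (4 d ^ 3)` for `1 ≤ j ≤ d`. -/
noncomputable def squareNode (d j : ℕ) : ℝ := ((4 * d ^ 3 / j ^ 2 : ℕ) : ℝ)⁻¹

theorem squareNode_zero (d : ℕ) : squareNode d 0 = 0 := by simp [squareNode]

theorem four_mul_cube_div_sq_pos {d j : ℕ} (hj : 1 ≤ j) (hjd : j ≤ d) :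
    0 < 4 * d ^ 3 / j ^ 2 :=
  Nat.div_pos (by nlinarith [Nat.pow_le_pow_left hjd 2, pow_pos (by omega : 0 < d) 2])
    (by positivity)

theorem squareNode_pos {d j : ℕ} (hj : 1 ≤ j) (hjd : j ≤ d) : 0 < squareNode d j :=
  inv_pos.2 (by exact_mod_cast four_mul_cube_div_sq_pos hj hjd)

theorem squareNode_injOn (d : ℕ) :
    Set.InjOn (squareNode d) (Finset.range (d + 1) : Finset ℕ) := by
  intro i hi j hj hij
  have hi' := Finset.mem_range.1 (Finset.mem_coe.1 hi)
  have hj' := Finset.mem_range.1 (Finset.mem_coe.1 hj)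
  by_contra hne
  rcases Nat.eq_zero_or_pos i with rfl | hi0
  · rw [squareNode_zero] at hij
    exact (squareNode_pos (j := j) (by omega) (by omega)).ne hij
  rcases Nat.eq_zero_or_pos j with rfl | hj0
  · rw [squareNode_zero] at hij
    exact (squareNode_pos hi0 (by omega)).ne' hij
  have := (four_mul_cube_div_sq_ratio_le (d := d) hi0 (by omega) hj0 (by omega) hne).1
  rw [squareNode, squareNode, inv_inj] at hij
  rw [hij, sub_self, abs_zero] at this
  exact lt_irrefl _ this

/-- The Lagrange basis polynomials at the nodes, except the one of the node `0`, are small near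
`0`: each is at most a constant times its slope factor `y / squareNode d j`. -/
theorem abs_eval_basis_squareNode_le {d j r : ℕ} (hj : 1 ≤ j) (hjd : j ≤ d)
    (hr : 4 * d ^ 3 ≤ r) :
    |(Lagrange.basis (Finset.range (d + 1)) (squareNode d) j).eval (r : ℝ)⁻¹| ≤
      (4 * d ^ 3 * (r : ℝ)⁻¹ * 2) * (1 / (j : ℝ) ^ 2) := by
  have hd : 0 < d := by omega
  have hr0 : 0 < r := lt_of_lt_of_le (by positivity) hr
  have hrpos : (0 : ℝ) < (r : ℝ)⁻¹ := by positivity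
  have hset : (Finset.range (d + 1)).erase j = insert 0 ((Finset.Icc 1 d).erase j) := by
    ext i
    simp only [Finset.mem_erase, Finset.mem_range, Finset.mem_insert, Finset.mem_Icc]
    omega
  have hfac : ∀ i, |(Lagrange.basisDivisor (squareNode d j) (squareNode d i)).eval (r : ℝ)⁻¹| =
      |(r : ℝ)⁻¹ - squareNode d i| / |squareNode d j - squareNode d i| := by
    intro i
    simp [Lagrange.basisDivisor, abs_mul, abs_inv, div_eq_inv_mul]
  have hsj : (0 : ℝ) < ((4 * d ^ 3 / j ^ 2 : ℕ) : ℝ) := by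
    exact_mod_cast four_mul_cube_div_sq_pos hj hjd
  have hzero : |(Lagrange.basisDivisor (squareNode d j) (squareNode d 0)).eval (r : ℝ)⁻¹| =
      ((4 * d ^ 3 / j ^ 2 : ℕ) : ℝ) * (r : ℝ)⁻¹ := by
    rw [hfac, squareNode_zero, sub_zero, sub_zero, abs_of_pos hrpos,
      abs_of_pos (squareNode_pos hj hjd), squareNode, div_inv_eq_mul, mul_comm]
  have hprod : ∏ i ∈ (Finset.Icc 1 d).erase j,
      |(Lagrange.basisDivisor (squareNode d j) (squareNode d i)).eval (r : ℝ)⁻¹| ≤ 2 := by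
    refine le_trans (Finset.prod_le_prod (fun _ _ => abs_nonneg _) fun i hi => ?_)
      (prod_four_mul_cube_div_sq_ratio_le hj hjd)
    rw [Finset.mem_erase, Finset.mem_Icc] at hi
    have hsi : (0 : ℝ) < ((4 * d ^ 3 / i ^ 2 : ℕ) : ℝ) := by
      exact_mod_cast four_mul_cube_div_sq_pos hi.2.1 hi.2.2
    have hle : (r : ℝ)⁻¹ ≤ squareNode d i :=
      inv_anti₀ hsi (by exact_mod_cast (Nat.div_le_self _ _).trans hr)
    have hsep := (four_mul_cube_div_sq_ratio_le hi.2.1 hi.2.2 hj hjd hi.1).1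
    rw [hfac]
    unfold squareNode at hle ⊢
    generalize ((4 * d ^ 3 / j ^ 2 : ℕ) : ℝ) = a at *
    generalize ((4 * d ^ 3 / i ^ 2 : ℕ) : ℝ) = b at *
    have hab : |a⁻¹ - b⁻¹| = |a - b| / (a * b) := by
      rw [inv_sub_inv hsj.ne' hsi.ne', abs_div, abs_sub_comm, abs_of_pos (mul_pos hsj hsi)]
    calc |(r : ℝ)⁻¹ - b⁻¹| / |a⁻¹ - b⁻¹| ≤ b⁻¹ / |a⁻¹ - b⁻¹| := by
          gcongr
          rw [abs_of_nonpos (by linarith)]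
          linarith
      _ = a / |a - b| := by
          rw [hab]
          field_simp
  have hsj' : ((4 * d ^ 3 / j ^ 2 : ℕ) : ℝ) ≤ 4 * d ^ 3 / (j : ℝ) ^ 2 :=
    cast_four_mul_cube_div_sq_le d j
  rw [Lagrange.basis, Polynomial.eval_prod, hset, Finset.prod_insert (by simp), abs_mul,
    Finset.abs_prod, hzero]
  refine (mul_le_mul (mul_le_mul_of_nonneg_right hsj' hrpos.le) hprod
    (Finset.prod_nonneg fun _ _ => abs_nonneg _) (by positivity)).trans (le_of_eq ?_)
  ring

/-- A polynomial of degree `d` with values in `[0, 1]` at `0` and at `1, 1/2, …, 1/n` varies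
slowly near `0`. The proof interpolates at `0` and at the points `1 / ⌊4 d ^ 3 / j ^ 2⌋` for
`1 ≤ j ≤ d`, whose spacing is close to that of the Chebyshev nodes of an interval of length of
order `1 / d`. -/
theorem abs_eval_inv_sub_eval_zero_le {P : Polynomial ℝ} {d n r : ℕ} (hP : P.natDegree ≤ d)
    (hd : 1 ≤ d) (h0 : P.eval 0 ∈ Set.Icc (0 : ℝ) 1)
    (h1 : ∀ s : ℕ, 1 ≤ s → s ≤ n → P.eval (s : ℝ)⁻¹ ∈ Set.Icc (0 : ℝ) 1)
    (hr : 4 * d ^ 3 ≤ r) (hrn : r ≤ n) :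
    |P.eval (r : ℝ)⁻¹ - P.eval 0| ≤ 16 * d ^ 3 / r := by
  set v := squareNode d with hv
  set Q : Polynomial ℝ := P - Polynomial.C (P.eval 0) with hQ
  have hQeval : ∀ x, Q.eval x = P.eval x - P.eval 0 := fun x => by simp [hQ]
  have hQdeg : Q.degree < (Finset.range (d + 1)).card := by
    refine (Polynomial.degree_le_natDegree).trans_lt ?_
    rw [Finset.card_range, hQ, Polynomial.natDegree_sub_C]
    exact_mod_cast Nat.lt_succ_of_le hP
  have hset : Finset.range (d + 1) = insert 0 (Finset.Icc 1 d) := by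
    ext i
    simp only [Finset.mem_range, Finset.mem_insert, Finset.mem_Icc]
    omega
  have hexp : Q.eval (r : ℝ)⁻¹ =
      ∑ j ∈ Finset.Icc 1 d, Q.eval (v j) *
        (Lagrange.basis (Finset.range (d + 1)) v j).eval (r : ℝ)⁻¹ := by
    conv_lhs => rw [Lagrange.eq_interpolate (squareNode_injOn d) hQdeg]
    rw [Lagrange.interpolate_apply, Polynomial.eval_finsetSum]
    conv_lhs => enter [1]; rw [hset]
    rw [Finset.sum_insert (by simp), squareNode_zero, hQeval 0]
    simp [hv]
  rw [← hQeval, hexp]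
  calc _ ≤ ∑ j ∈ Finset.Icc 1 d, |Q.eval (v j) *
        (Lagrange.basis (Finset.range (d + 1)) v j).eval (r : ℝ)⁻¹| :=
        Finset.abs_sum_le_sum_abs _ _
    _ ≤ ∑ j ∈ Finset.Icc 1 d, (4 * d ^ 3 * (r : ℝ)⁻¹ * 2) * (1 / (j : ℝ) ^ 2) := by
        refine Finset.sum_le_sum fun j hj => ?_
        obtain ⟨hj1, hjd⟩ := Finset.mem_Icc.1 hj
        have h2 : P.eval (v j) ∈ Set.Icc (0 : ℝ) 1 :=
          h1 _ (four_mul_cube_div_sq_pos hj1 hjd) (((Nat.div_le_self _ _).trans hr).trans hrn)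
        have hQ1 : |Q.eval (v j)| ≤ 1 := by
          rw [hQeval, abs_le]
          constructor <;> linarith [h0.1, h0.2, h2.1, h2.2]
        rw [abs_mul]
        exact (mul_le_of_le_one_left (abs_nonneg _) hQ1).trans
          (abs_eval_basis_squareNode_le hj1 hjd hr)
    _ ≤ (4 * d ^ 3 * (r : ℝ)⁻¹ * 2) * 2 := by
        rw [← Finset.mul_sum]
        gcongr
        exact sum_Icc_one_div_sq_le d hd
    _ = _ := by ring

/-! ### Juntas and the small-range distribution -/

/-- The additive submonoid of complex functions of `g : Fin n → Fin M` generated by the functions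
that depend on at most `k` values of `g`. -/
def juntaSpan (n M k : ℕ) : AddSubmonoid ((Fin n → Fin M) → ℂ) :=
  AddSubmonoid.closure {F | ∃ T : Finset (Fin n), T.card ≤ k ∧ DependsOn F (T : Set (Fin n))}

theorem mem_juntaSpan_of_dependsOn {n M k : ℕ} {F : (Fin n → Fin M) → ℂ} {T : Finset (Fin n)}
    (hT : T.card ≤ k) (hF : DependsOn F (T : Set (Fin n))) : F ∈ juntaSpan n M k :=
  AddSubmonoid.subset_closure ⟨T, hT, hF⟩

theorem const_mem_juntaSpan {n M k : ℕ} (c : ℂ) : (fun _ => c) ∈ juntaSpan n M k :=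
  mem_juntaSpan_of_dependsOn (T := ∅) (by simp) (fun _ _ _ => rfl)

theorem mul_mem_juntaSpan {n M k l : ℕ} {F G : (Fin n → Fin M) → ℂ} (hF : F ∈ juntaSpan n M k)
    (hG : G ∈ juntaSpan n M l) : F * G ∈ juntaSpan n M (k + l) := by
  induction hF using AddSubmonoid.closure_induction with
  | zero => rw [zero_mul]; exact zero_mem _
  | add F H _ _ h1 h2 => rw [add_mul]; exact add_mem h1 h2
  | mem F hF =>
    obtain ⟨T, hT, hF⟩ := hF
    induction hG using AddSubmonoid.closure_induction with
    | zero => rw [mul_zero]; exact zero_mem _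
    | add G H _ _ h1 h2 => rw [mul_add]; exact add_mem h1 h2
    | mem G hG =>
      obtain ⟨U, hU, hG⟩ := hG
      refine mem_juntaSpan_of_dependsOn (T := T ∪ U)
        ((Finset.card_union_le _ _).trans (add_le_add hT hU)) fun x y h => ?_
      rw [Pi.mul_apply, Pi.mul_apply, hF fun i hi => h i (by simp_all),
        hG fun i hi => h i (by simp_all)]

theorem conj_mem_juntaSpan {n M k : ℕ} {F : (Fin n → Fin M) → ℂ} (hF : F ∈ juntaSpan n M k) :
    star F ∈ juntaSpan n M k := by
  induction hF using AddSubmonoid.closure_induction with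
  | mem F hF =>
    obtain ⟨T, hT, hF⟩ := hF
    exact mem_juntaSpan_of_dependsOn hT fun x y h => by simp [hF h]
  | zero => rw [star_zero]; exact zero_mem _
  | add F G _ _ h1 h2 => rw [star_add]; exact add_mem h1 h2

theorem Equiv.Perm.exists_comp_eqOn {n : ℕ} {T : Set (Fin n)} {y y' : Fin n → Fin n}
    (h : ∀ i ∈ T, ∀ j ∈ T, y i = y j ↔ y' i = y' j) :
    ∃ τ : Equiv.Perm (Fin n), ∀ i ∈ T, τ (y i) = y' i := by
  classical
  have hy' : ∀ a : {a // a ∈ y '' T}, ∃ i ∈ T, y i = a := fun a => a.2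
  choose c hcT hc using hy'
  have hbij : Function.Bijective
      (fun a : {a // a ∈ y '' T} => (⟨y' (c a), c a, hcT a, rfl⟩ : {a // a ∈ y' '' T})) := by
    constructor
    · intro a b hab
      have : y' (c a) = y' (c b) := congrArg Subtype.val hab
      rw [← h _ (hcT a) _ (hcT b), hc, hc] at this
      exact Subtype.ext this
    · rintro ⟨_, i, hi, rfl⟩
      refine ⟨⟨y i, i, hi, rfl⟩, Subtype.ext ?_⟩
      exact (h _ (hcT _) _ hi).1 (hc _)
  refine ⟨(Equiv.ofBijective _ hbij).extendSubtype, fun i hi => ?_⟩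
  rw [Equiv.extendSubtype_apply_of_mem _ _ ⟨i, hi, rfl⟩]
  exact (h _ (hcT _) _ hi).1 (hc _)

/-- The mean of `F` over the orbit of `y` under relabelling of the values. -/
noncomputable def orbitMean {n : ℕ} (F : (Fin n → Fin n) → ℝ) (y : Fin n → Fin n) : ℝ :=
  𝔼 σ : Equiv.Perm (Fin n), F (σ ∘ y)

/-- For a function `F` of `y` restricted to `T`, the mean over relabellings depends only on which
values of `y` on `T` coincide. -/
theorem orbitMean_eq_of_ker {n : ℕ} {F : (Fin n → Fin n) → ℝ} {T : Set (Fin n)}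
    (hF : DependsOn F T) {y y' : Fin n → Fin n}
    (h : ∀ i ∈ T, ∀ j ∈ T, y i = y j ↔ y' i = y' j) : orbitMean F y = orbitMean F y' := by
  obtain ⟨τ, hτ⟩ := Equiv.Perm.exists_comp_eqOn h
  refine (Fintype.expect_equiv (Equiv.mulRight τ) _ _ fun σ => ?_).symm
  exact hF fun i hi => by simp [hτ i hi]

theorem smallRangeExpect_eq_expect_orbitMean {n r : ℕ} (F : (Fin n → Fin n) → ℝ) :
    smallRangeExpect n r F =
      𝔼 g : Fin n → Fin r, 𝔼 h : Fin r ↪ Fin n, orbitMean F (h ∘ g) := by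
  refine Finset.expect_congr rfl fun g _ => ?_
  unfold orbitMean
  rw [Finset.expect_comm]
  have key : ∀ σ : Equiv.Perm (Fin n), 𝔼 h : Fin r ↪ Fin n, F (σ ∘ h ∘ g) =
      𝔼 h : Fin r ↪ Fin n, F (h ∘ g) := fun σ =>
    Fintype.expect_equiv (Equiv.embeddingCongr (Equiv.refl _) σ) _ _ fun h => by
      congr 1
  rw [Finset.expect_congr rfl fun σ _ => key σ, Fintype.expect_const]

/-- A function on `T ⊆ Fin n` whose fibres are the classes of `s`: every element of `T` goes to a
representative of its class. -/
noncomputable def classRep {n : ℕ} {T : Finset (Fin n)} (s : Setoid T) (i : Fin n) : Fin n :=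
  if hi : i ∈ T then ((Quotient.mk s ⟨i, hi⟩).out : T) else i

theorem classRep_eq_iff {n : ℕ} {T : Finset (Fin n)} (s : Setoid T) (i j : T) :
    classRep s i = classRep s j ↔ s i j := by
  simp only [classRep, i.2, j.2, dif_pos, Subtype.coe_eta, Subtype.coe_inj, Quotient.out_inj]
  exact Quotient.eq

noncomputable instance Setoid.instFintypeOfFinite {α : Type*} [Finite α] : Fintype (Setoid α) :=
  have : Finite (Setoid α) := Finite.of_injective (fun s : Setoid α => fun a b => s a b)
    fun _ _ h => Setoid.ext fun a b => iff_of_eq (congrFun (congrFun h a) b)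
  Fintype.ofFinite _

/-- A function with kernel `s` is an injective function on the classes of `s`. -/
theorem Setoid.card_ker_eq {α β : Type*} [Fintype β] (s : Setoid α) [Fintype (Quotient s)]
    [Fintype {y : α → β // Setoid.ker y = s}] :
    Fintype.card {y : α → β // Setoid.ker y = s} =
      (Fintype.card β).descFactorial (Fintype.card (Quotient s)) := by
  classical
  rw [← Fintype.card_embedding_eq]
  refine Fintype.card_congr
    { toFun := fun y => ⟨Quotient.lift y.1 fun a b hab => by
          have : Setoid.ker y.1 a b := by rw [y.2]; exact hab
          exact this, ?_⟩
      invFun := fun e => ⟨fun a => e (Quotient.mk s a), ?_⟩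
      left_inv := fun y => rfl
      right_inv := fun e => ?_ }
  · rintro ⟨a⟩ ⟨b⟩ hab
    have : Setoid.ker y.1 a b := hab
    rw [y.2] at this
    exact Quotient.sound this
  · ext a b
    rw [Setoid.ker_def, e.injective.eq_iff]
    exact Quotient.eq
  · ext ⟨a⟩
    rfl

open Classical in
theorem card_quotient_eq_iff_eq_bot {α : Type*} [Fintype α] (s : Setoid α) :
    Fintype.card (Quotient s) = Fintype.card α ↔ s = ⊥ := by
  constructor
  · intro h
    have hinj : Function.Injective (Quotient.mk s) :=
      ((Fintype.bijective_iff_surjective_and_card _).2 ⟨Quotient.mk_surjective, h.symm⟩).1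
    ext a b
    rw [Setoid.bot_def]
    exact ⟨fun hab => hinj (Quotient.sound hab), fun hab => hab ▸ s.refl a⟩
  · rintro rfl
    exact (Fintype.card_of_bijective (f := Quotient.mk (⊥ : Setoid α))
      ⟨fun a b h => Quotient.exact h, Quotient.mk_surjective⟩).symm

open Polynomial in
/-- The polynomial in `1 / r` that gives the probability that `k` uniformly random elements of
`Fin r` form a prescribed pattern of `m` classes of coinciding elements. -/
noncomputable def patternPoly (k m : ℕ) : ℝ[X] :=
  X ^ (k - m) * ∏ i ∈ Finset.range m, (1 - C (i : ℝ) * X)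

open Polynomial in
theorem patternPoly_natDegree_le {k m : ℕ} (h : m ≤ k) : (patternPoly k m).natDegree ≤ k := by
  refine natDegree_mul_le.trans ?_
  have h1 : (∏ i ∈ Finset.range m, (1 - C (i : ℝ) * X)).natDegree ≤ m := by
    refine (natDegree_prod_le _ _).trans ?_
    calc _ ≤ ∑ i ∈ Finset.range m, 1 := Finset.sum_le_sum fun i _ => by compute_degree
      _ = m := by simp
  have h2 : (X ^ (k - m) : ℝ[X]).natDegree ≤ k - m := natDegree_X_pow_le _
  omega

theorem patternPoly_eval_inv {k m r : ℕ} (h : m ≤ k) (hr : 1 ≤ r) :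
    (patternPoly k m).eval (r : ℝ)⁻¹ = (r.descFactorial m : ℝ) / r ^ k := by
  have hr' : (r : ℝ) ≠ 0 := by positivity
  have h1 : ∏ i ∈ Finset.range m, (1 - (i : ℝ) * (r : ℝ)⁻¹) =
      (r.descFactorial m : ℝ) / r ^ m := by
    rw [← descPochhammer_eval_eq_descFactorial, descPochhammer_eval_eq_prod_range]
    rw [show (r : ℝ) ^ m = ∏ i ∈ Finset.range m, (r : ℝ) by simp, ← Finset.prod_div_distrib]
    exact Finset.prod_congr rfl fun i _ => by field_simp
  simp only [patternPoly, Polynomial.eval_mul, Polynomial.eval_pow, Polynomial.eval_X,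
    Polynomial.eval_prod, Polynomial.eval_sub, Polynomial.eval_one, Polynomial.eval_C]
  rw [h1, inv_pow, inv_mul_eq_div, div_div, ← pow_add, Nat.add_sub_cancel' h]

theorem patternPoly_eval_zero {k m : ℕ} (h : m ≤ k) :
    (patternPoly k m).eval 0 = if m = k then 1 else 0 := by
  simp only [patternPoly, Polynomial.eval_mul, Polynomial.eval_pow, Polynomial.eval_X,
    Polynomial.eval_prod, Polynomial.eval_sub, Polynomial.eval_one, Polynomial.eval_C]
  split_ifs with hm
  · simp [hm]
  · rw [zero_pow (by omega), zero_mul]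

/-- The mean over functions `g` of a function of the restriction of `g` to `T`. -/
theorem expect_restrict {n r : ℕ} (hr : 1 ≤ r) (T : Finset (Fin n)) (Φ : (T → Fin r) → ℝ) :
    𝔼 g : Fin n → Fin r, Φ (fun i => g i) = (∑ y : T → Fin r, Φ y) / r ^ T.card := by
  classical
  have : Nonempty (Fin r) := ⟨⟨0, hr⟩⟩
  refine (Fintype.expect_equiv (Equiv.piEquivPiSubtypeProd (· ∈ T) fun _ => Fin r) _
    (fun p => Φ p.1) fun g => rfl).trans ?_
  rw [← Finset.univ_product_univ,
    Finset.expect_product' Finset.univ Finset.univ fun y _ => Φ y]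
  simp only [Fintype.expect_const]
  rw [Fintype.expect_eq_sum_div_card]
  simp

/-- A function depending on at most `k` values of its argument has a small-range mean that is a
polynomial in `1 / r`, and the value of this polynomial at `0` is the mean over permutations: for
`r → ∞`, only injective patterns survive. -/
theorem exists_poly_of_dependsOn {n k : ℕ} {F : (Fin n → Fin n) → ℝ} {T : Finset (Fin n)}
    (hT : T.card ≤ k) (hF : DependsOn F (T : Set (Fin n))) :
    ∃ P : Polynomial ℝ, P.natDegree ≤ k ∧
      (∀ r : ℕ, 1 ≤ r → r ≤ n → smallRangeExpect n r F = P.eval (r : ℝ)⁻¹) ∧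
      𝔼 π : Equiv.Perm (Fin n), F π = P.eval 0 := by
  classical
  have hquot : ∀ s : Setoid T, Fintype.card (Quotient s) ≤ T.card := fun s => by
    simpa using Fintype.card_quotient_le s
  refine ⟨∑ s : Setoid T, Polynomial.C (orbitMean F (classRep s)) *
    patternPoly T.card (Fintype.card (Quotient s)), ?_, fun r hr hrn => ?_, ?_⟩
  · refine Polynomial.natDegree_sum_le_of_forall_le _ _ fun s _ => ?_
    exact (Polynomial.natDegree_C_mul_le _ _).trans
      ((patternPoly_natDegree_le (hquot s)).trans hT)
  · have : Nonempty (Fin r ↪ Fin n) := ⟨Fin.castLEEmb hrn⟩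
    have h1 : ∀ (g : Fin n → Fin r) (h : Fin r ↪ Fin n), orbitMean F (h ∘ g) =
        orbitMean F (classRep (Setoid.ker fun i : T => g i)) := fun g h =>
      orbitMean_eq_of_ker hF fun i hi j hj => by
        rw [Function.comp_apply, Function.comp_apply, h.injective.eq_iff]
        exact (classRep_eq_iff (Setoid.ker fun i : T => g i) ⟨i, hi⟩ ⟨j, hj⟩).symm
    rw [smallRangeExpect_eq_expect_orbitMean]
    simp only [h1, Fintype.expect_const]
    rw [expect_restrict hr T fun y => orbitMean F (classRep (Setoid.ker y)),
      Polynomial.eval_finsetSum,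
      ← Finset.sum_fiberwise Finset.univ (fun y : T → Fin r => Setoid.ker y), Finset.sum_div]
    refine Finset.sum_congr rfl fun s _ => ?_
    rw [Polynomial.eval_mul, Polynomial.eval_C, patternPoly_eval_inv (hquot s) hr,
      Finset.sum_congr rfl fun y hy => by rw [(Finset.mem_filter.1 hy).2], Finset.sum_const,
      ← Fintype.card_subtype, Setoid.card_ker_eq s, Fintype.card_fin, nsmul_eq_mul]
    ring
  · have h1 : (𝔼 π : Equiv.Perm (Fin n), F π) = orbitMean F id := rfl
    rw [h1, Polynomial.eval_finsetSum, Finset.sum_eq_single ⊥]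
    · rw [Polynomial.eval_mul, Polynomial.eval_C, patternPoly_eval_zero (hquot _),
        if_pos (by simpa using (card_quotient_eq_iff_eq_bot (⊥ : Setoid T)).2 rfl), mul_one]
      refine orbitMean_eq_of_ker hF fun i hi j hj => ?_
      rw [classRep_eq_iff ⊥ ⟨i, hi⟩ ⟨j, hj⟩, Setoid.bot_def]
      simp
    · intro s _ hs
      rw [Polynomial.eval_mul, patternPoly_eval_zero (hquot s), if_neg, mul_zero]
      intro h
      exact hs ((card_quotient_eq_iff_eq_bot s).1 (by simpa using h))
    · simp

theorem exists_poly_of_mem_juntaSpan {n k : ℕ} {F : (Fin n → Fin n) → ℂ}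
    (hF : F ∈ juntaSpan n n k) :
    ∃ P : Polynomial ℝ, P.natDegree ≤ k ∧
      (∀ r : ℕ, 1 ≤ r → r ≤ n → smallRangeExpect n r (fun g => (F g).re) = P.eval (r : ℝ)⁻¹) ∧
      𝔼 π : Equiv.Perm (Fin n), (F π).re = P.eval 0 := by
  induction hF using AddSubmonoid.closure_induction with
  | mem F hF =>
    obtain ⟨T, hT, hF⟩ := hF
    exact exists_poly_of_dependsOn hT fun x y h => by simp only [hF h]
  | zero => exact ⟨0, by simp, by simp [smallRangeExpect], by simp⟩
  | add F G _ _ h1 h2 =>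
    obtain ⟨P, hP, hP1, hP0⟩ := h1
    obtain ⟨Q, hQ, hQ1, hQ0⟩ := h2
    refine ⟨P + Q, (Polynomial.natDegree_add_le _ _).trans (max_le hP hQ), fun r hr hrn => ?_, ?_⟩
    · rw [Polynomial.eval_add, ← hP1 r hr hrn, ← hQ1 r hr hrn]
      simp [smallRangeExpect, Finset.expect_add_distrib]
    · rw [Polynomial.eval_add, ← hP0, ← hQ0]
      simp [Finset.expect_add_distrib]

/-! ### The polynomial method for quantum query algorithms -/

namespace QGate

variable {n M : ℕ} {W : Type} [Fintype W] [DecidableEq W]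

theorem apply_unitary (g : Fin n → Fin M) (ψ : Fin n × Fin M × W → ℂ)
    (U : Matrix.unitaryGroup (Fin n × Fin M × W) ℂ) :
    apply g ψ (unitary U) =
      (U : Matrix (Fin n × Fin M × W) (Fin n × Fin M × W) ℂ).mulVec ψ := rfl

theorem apply_query (g : Fin n → Fin M) (ψ : Fin n × Fin M × W → ℂ) :
    apply g ψ query = fun k => ψ (k.1, k.2.1 - g k.1, k.2.2) := rfl

theorem apply_permUnitary (g : Fin n → Fin M) (ψ : Fin n × Fin M × W → ℂ)
    (σ : Equiv.Perm (Fin n × Fin M × W)) :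
    apply g ψ (unitary (permUnitary σ)) = ψ ∘ σ :=
  Matrix.permMatrix_mulVec σ

/-- A gate preserves the norm of the state. -/
theorem sum_norm_sq_apply (g : Fin n → Fin M) (ψ : Fin n × Fin M × W → ℂ)
    (G : QGate (Fin n × Fin M × W)) : ∑ k, ‖apply g ψ G k‖ ^ 2 = ∑ k, ‖ψ k‖ ^ 2 := by
  cases G with
  | unitary U =>
    have key : ∀ φ : Fin n × Fin M × W → ℂ,
        ((∑ k, ‖φ k‖ ^ 2 : ℝ) : ℂ) = star φ ⬝ᵥ φ := fun φ => by
      simp [dotProduct, Complex.conj_mul']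
    have h := Unitary.coe_star_mul_self U
    rw [Matrix.star_eq_conjTranspose] at h
    apply Complex.ofReal_injective
    rw [key, key, apply_unitary, Matrix.star_mulVec, Matrix.dotProduct_mulVec,
      Matrix.vecMul_vecMul, h, Matrix.vecMul_one]
  | query =>
    rcases Nat.eq_zero_or_pos M with rfl | hM
    · exact Finset.sum_congr rfl fun k _ => k.2.1.elim0
    have : NeZero M := ⟨hM.ne'⟩
    refine Fintype.sum_equiv (Equiv.prodShear (Equiv.refl (Fin n))
      fun i => Equiv.prodCongr (Equiv.subRight (g i)) (Equiv.refl W)) _ _ fun k => ?_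
    rfl

/-- One gate enlarges the number of oracle values on which the amplitudes depend by at most the
number of its oracle calls. -/
theorem apply_mem_juntaSpan {ψ : (Fin n → Fin M) → Fin n × Fin M × W → ℂ} {m : ℕ}
    (hψ : ∀ k, (fun g => ψ g k) ∈ juntaSpan n M m) (G : QGate (Fin n × Fin M × W))
    (k : Fin n × Fin M × W) :
    (fun g => apply g (ψ g) G k) ∈ juntaSpan n M (m + if G.isQuery then 1 else 0) := by
  cases G with
  | unitary U =>
    have h : (fun g => apply g (ψ g) (unitary U) k) =
        ∑ l, (fun _ => (U : Matrix _ _ ℂ) k l) * fun g => ψ g l := by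
      funext g
      simp [apply_unitary, Matrix.mulVec, dotProduct]
    rw [h]
    refine sum_mem fun l _ => ?_
    simpa [isQuery] using mul_mem_juntaSpan (const_mem_juntaSpan (k := 0) _) (hψ l)
  | query =>
    have h : (fun g => apply g (ψ g) query k) =
        ∑ j, (fun g => ψ g (k.1, k.2.1 - j, k.2.2)) * fun g => if g k.1 = j then 1 else 0 := by
      funext g
      simp [apply_query]
    rw [h]
    refine sum_mem fun j _ => mul_mem_juntaSpan (hψ _)
      (mem_juntaSpan_of_dependsOn (T := {k.1}) (by simp [isQuery]) fun x y hxy => ?_)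
    rw [hxy k.1 (by simp)]

theorem foldl_apply_mem_juntaSpan (L : List (QGate (Fin n × Fin M × W))) :
    ∀ {ψ : (Fin n → Fin M) → Fin n × Fin M × W → ℂ} {m : ℕ},
      (∀ k, (fun g => ψ g k) ∈ juntaSpan n M m) → ∀ k,
      (fun g => L.foldl (apply g) (ψ g) k) ∈ juntaSpan n M (m + L.countP isQuery) := by
  induction L with
  | nil => exact fun hψ k => hψ k
  | cons G L ih =>
    intro ψ m hψ k
    rw [List.countP_cons, add_comm (List.countP _ _), ← add_assoc]
    exact ih (apply_mem_juntaSpan hψ G) k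

end QGate

namespace QueryAlg

variable {n M : ℕ}

theorem sum_norm_sq_finalState (A : QueryAlg n M) (g : Fin n → Fin M) :
    ∑ k, ‖A.finalState g k‖ ^ 2 = 1 := by
  have h : ∀ (L : List (QGate A.Basis)) (ψ : A.Basis → ℂ),
      ∑ k, ‖L.foldl (QGate.apply g) ψ k‖ ^ 2 = ∑ k, ‖ψ k‖ ^ 2 := fun L => by
    induction L with
    | nil => exact fun ψ => rfl
    | cons G L ih => exact fun ψ => (ih _).trans (QGate.sum_norm_sq_apply g ψ G)
  rw [finalState, h, Finset.sum_eq_single A.init]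
  · simp
  · intro k _ hk
    simp [Pi.single_eq_of_ne hk]
  · simp

theorem outputProb_add_outputProb_not (A : QueryAlg n M) (g : Fin n → Fin M) (b : Bool) :
    A.outputProb g b + A.outputProb g (!b) = 1 := by
  rw [outputProb, outputProb, ← Finset.sum_add_distrib, ← A.sum_norm_sq_finalState g]
  refine Finset.sum_congr rfl fun k _ => ?_
  cases A.out k <;> cases b <;> simp

theorem outputProb_nonneg (A : QueryAlg n M) (g : Fin n → Fin M) (b : Bool) :
    0 ≤ A.outputProb g b :=
  Finset.sum_nonneg fun k _ => by split_ifs <;> positivity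

theorem outputProb_le_one (A : QueryAlg n M) (g : Fin n → Fin M) (b : Bool) :
    A.outputProb g b ≤ 1 := by
  have h1 := A.outputProb_add_outputProb_not g b
  have h2 := A.outputProb_nonneg g (!b)
  linarith

/-- The polynomial method: output probabilities are combinations of functions depending on at
most twice as many oracle values as there are queries. -/
theorem exists_outputProb_mem_juntaSpan (A : QueryAlg n M) (b : Bool) :
    ∃ F ∈ juntaSpan n M (2 * A.queries), ∀ g, (F g).re = A.outputProb g b := by
  have hψ : ∀ k, (fun g => A.finalState g k) ∈ juntaSpan n M A.queries := fun k => by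
    have h := QGate.foldl_apply_mem_juntaSpan A.gates
      (ψ := fun _ => Pi.single A.init (1 : ℂ)) (m := 0) (fun k => const_mem_juntaSpan _) k
    rwa [zero_add] at h
  refine ⟨∑ k, if A.out k = b then (fun g => A.finalState g k) * star (fun g => A.finalState g k)
    else 0, sum_mem fun k _ => ?_, fun g => ?_⟩
  · split_ifs
    · rw [two_mul]
      exact mul_mem_juntaSpan (hψ k) (conj_mem_juntaSpan (hψ k))
    · exact zero_mem _
  · rw [Finset.sum_apply, Complex.re_sum, outputProb]
    refine Finset.sum_congr rfl fun k _ => ?_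
    split_ifs
    · rw [Pi.mul_apply, Pi.star_apply, Complex.star_def, Complex.mul_conj, Complex.ofReal_re,
        Complex.normSq_eq_norm_sq]
    · rfl

end QueryAlg

theorem smallRangeExpect_mem_Icc {n r : ℕ} (hr : 1 ≤ r) (hrn : r ≤ n)
    {F : (Fin n → Fin n) → ℝ} (hF : ∀ C, F C ∈ Set.Icc (0 : ℝ) 1) :
    smallRangeExpect n r F ∈ Set.Icc (0 : ℝ) 1 := by
  have : Nonempty (Fin r) := ⟨⟨0, hr⟩⟩
  have : Nonempty (Fin r ↪ Fin n) := ⟨Fin.castLEEmb hrn⟩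
  exact ⟨Finset.expect_nonneg fun g _ => Finset.expect_nonneg fun h _ => (hF _).1,
    Finset.expect_le Finset.univ_nonempty fun g _ =>
      Finset.expect_le Finset.univ_nonempty fun h _ => (hF _).2⟩

/-- The quantum lower bound for telling a random permutation from a small-range function. The
constant comes from `16 (2 q) ^ 3 / r ≤ 2 / 27` for `r ≥ (12 q) ^ 3`. -/
theorem isSmallRangeConstant_one_div_twelve : IsSmallRangeConstant (1 / 12) := by
  intro n r hr hrn B hB b
  obtain ⟨F, hF, hFB⟩ := B.exists_outputProb_mem_juntaSpan b
  obtain ⟨P, hPdeg, hP, hP0⟩ := exists_poly_of_mem_juntaSpan hF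
  simp only [hFB] at hP hP0
  rw [hP0, hP r hr hrn, abs_sub_comm]
  have hB01 : ∀ C, B.outputProb C b ∈ Set.Icc (0 : ℝ) 1 := fun C =>
    ⟨B.outputProb_nonneg C b, B.outputProb_le_one C b⟩
  rcases Nat.eq_zero_or_pos B.queries with hq | hq
  · rw [hq] at hPdeg
    rw [Polynomial.eq_C_of_natDegree_le_zero hPdeg]
    norm_num
  have hcube : (12 * (B.queries : ℝ)) ^ 3 ≤ (r : ℝ) := by
    have h1 : 12 * (B.queries : ℝ) ≤ (r : ℝ) ^ (1 / 3 : ℝ) := by linarith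
    calc (12 * (B.queries : ℝ)) ^ 3 ≤ ((r : ℝ) ^ (1 / 3 : ℝ)) ^ 3 := by gcongr
      _ = (r : ℝ) := by
        rw [← Real.rpow_natCast, ← Real.rpow_mul (by positivity)]
        norm_num
  have hcube' : (12 * B.queries) ^ 3 ≤ r := by exact_mod_cast hcube
  refine (abs_eval_inv_sub_eval_zero_le hPdeg (by omega) ?_
    (fun s hs hsn => ?_) ?_ hrn).trans ?_
  · rw [← hP0]
    exact ⟨Finset.expect_nonneg fun π _ => (hB01 _).1,
      Finset.expect_le Finset.univ_nonempty fun π _ => (hB01 _).2⟩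
  · rw [← hP s hs hsn]
    exact smallRangeExpect_mem_Icc hs hsn hB01
  · refine le_trans ?_ hcube'
    rw [mul_pow, mul_pow]
    omega
  · have hr' : (0 : ℝ) < r := by exact_mod_cast hr
    rw [div_le_iff₀ hr']
    push_cast
    nlinarith

/-! ### Three-fold amplification -/

namespace QueryAlg

variable {n M : ℕ}

theorem isQuery_liftGate (A : QueryAlg n M) (G : QGate A.Basis) :
    (A.liftGate G).isQuery = G.isQuery := by
  cases G <;> rfl

theorem queries_amplify3 (A : QueryAlg n M) : A.amplify3.queries = 3 * A.queries := by
  have h : A.stage.countP QGate.isQuery = A.queries := by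
    rw [stage, List.countP_append, List.countP_map,
      List.countP_congr (q := QGate.isQuery) fun G _ => by simp [isQuery_liftGate]]
    rfl
  change (A.stage ++ A.stage ++ A.stage).countP QGate.isQuery = _
  rw [List.countP_append, List.countP_append, h]
  ring

/-- The product state of three runs. -/
def tensor3 (A : QueryAlg n M) (φ χ ρ : A.Basis → ℂ) (k : Fin n × Fin M × A.Work3) : ℂ :=
  φ (A.splitRuns.symm k).1 * χ (A.splitRuns.symm k).2.1 * ρ (A.splitRuns.symm k).2.2

theorem apply_liftGate_tensor3 (A : QueryAlg n M) (g : Fin n → Fin M) (φ χ ρ : A.Basis → ℂ)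
    (G : QGate A.Basis) :
    QGate.apply g (A.tensor3 φ χ ρ) (A.liftGate G) = A.tensor3 (QGate.apply g φ G) χ ρ := by
  cases G with
  | query => rfl
  | unitary U =>
    funext k
    obtain ⟨t, rfl⟩ := A.splitRuns.surjective k
    rw [liftGate, QGate.apply_unitary, QGate.apply_unitary]
    simp only [tensor3, Matrix.mulVec, dotProduct, Equiv.symm_apply_apply]
    rw [← A.splitRuns.sum_comp, Fintype.sum_prod_type, Finset.sum_mul, Finset.sum_mul]
    refine Finset.sum_congr rfl fun a _ => ?_
    rw [Finset.sum_eq_single t.2]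
    · simp [Matrix.one_apply_eq, mul_assoc]
    · intro c _ hc
      simp [Matrix.one_apply_ne hc.symm]
    · simp

theorem foldl_stage_tensor3 (A : QueryAlg n M) (g : Fin n → Fin M) (φ χ ρ : A.Basis → ℂ) :
    A.stage.foldl (QGate.apply g) (A.tensor3 φ χ ρ) =
      A.tensor3 ρ (A.gates.foldl (QGate.apply g) φ) χ := by
  have h : ∀ (L : List (QGate A.Basis)) (φ : A.Basis → ℂ),
      (L.map A.liftGate).foldl (QGate.apply g) (A.tensor3 φ χ ρ) =
        A.tensor3 (L.foldl (QGate.apply g) φ) χ ρ := fun L => by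
    induction L with
    | nil => exact fun φ => rfl
    | cons G L ih =>
      intro φ
      rw [List.map_cons, List.foldl_cons, apply_liftGate_tensor3, ih]
      rfl
  rw [stage, List.foldl_append, h, List.foldl_cons, List.foldl_nil, QGate.apply_permUnitary]
  funext k
  change _ * _ * _ = _ * _ * _
  rw [mul_comm _ (ρ _), ← mul_assoc]
  rfl

theorem finalState_amplify3 (A : QueryAlg n M) (g : Fin n → Fin M) :
    A.amplify3.finalState g = A.tensor3 (A.finalState g) (A.finalState g) (A.finalState g) := by
  have hinit : (Pi.single (A.splitRuns (A.init, A.init, A.init)) 1 :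
      Fin n × Fin M × A.Work3 → ℂ) =
      A.tensor3 (Pi.single A.init 1) (Pi.single A.init 1) (Pi.single A.init 1) := by
    funext k
    obtain ⟨⟨t1, t2, t3⟩, rfl⟩ := A.splitRuns.surjective k
    have : A.splitRuns (t1, t2, t3) = A.splitRuns (A.init, A.init, A.init) ↔
        t1 = A.init ∧ t2 = A.init ∧ t3 = A.init := by
      rw [A.splitRuns.apply_eq_iff_eq]
      exact Prod.ext_iff.trans (and_congr_right fun _ => Prod.ext_iff)
    rw [Pi.single_apply, if_congr this rfl rfl, tensor3, Equiv.symm_apply_apply, Pi.single_apply, Pi.single_apply,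
      Pi.single_apply]
    by_cases h1 : t1 = A.init <;> by_cases h2 : t2 = A.init <;> by_cases h3 : t3 = A.init <;>
      simp [h1, h2, h3]
  have hrun : (A.stage ++ A.stage ++ A.stage).foldl (QGate.apply g)
      (Pi.single (A.splitRuns (A.init, A.init, A.init)) 1 : Fin n × Fin M × A.Work3 → ℂ) =
      A.tensor3 (A.finalState g) (A.finalState g) (A.finalState g) := by
    rw [hinit, List.foldl_append, List.foldl_append, foldl_stage_tensor3, foldl_stage_tensor3,
      foldl_stage_tensor3]
    rfl
  exact hrun

theorem outputProb_amplify3 (A : QueryAlg n M) (g : Fin n → Fin M) (b : Bool) :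
    A.amplify3.outputProb g b = A.outputProb g b ^ 2 * (3 - 2 * A.outputProb g b) := by
  have hsum : A.amplify3.outputProb g b = ∑ t1, ∑ t2, ∑ t3,
      if majority (A.out t1) (A.out t2) (A.out t3) = b then
        ‖A.finalState g t1‖ ^ 2 * ‖A.finalState g t2‖ ^ 2 * ‖A.finalState g t3‖ ^ 2 else 0 := by
    rw [outputProb, finalState_amplify3]
    refine (A.splitRuns.sum_comp _).symm.trans ?_
    rw [Fintype.sum_prod_type]
    refine Finset.sum_congr rfl fun t1 _ => ?_
    rw [Fintype.sum_prod_type]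
    refine Finset.sum_congr rfl fun t2 _ => Finset.sum_congr rfl fun t3 _ => ?_
    change (if majority (A.out t1) (A.out t2) (A.out t3) = b then
      ‖A.finalState g t1 * A.finalState g t2 * A.finalState g t3‖ ^ 2 else 0) = _
    rw [norm_mul, norm_mul, mul_pow, mul_pow]
  -- the weights of the basis states with output `b` and with the opposite output
  set u : A.Basis → ℝ := fun t => if A.out t = b then ‖A.finalState g t‖ ^ 2 else 0 with hu
  set v : A.Basis → ℝ := fun t => if A.out t = !b then ‖A.finalState g t‖ ^ 2 else 0 with hv
  have hterm : ∀ t1 t2 t3, (if majority (A.out t1) (A.out t2) (A.out t3) = b then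
        ‖A.finalState g t1‖ ^ 2 * ‖A.finalState g t2‖ ^ 2 * ‖A.finalState g t3‖ ^ 2 else 0) =
      u t1 * u t2 * u t3 + u t1 * u t2 * v t3 + u t1 * v t2 * u t3 + v t1 * u t2 * u t3 := by
    intro t1 t2 t3
    simp only [hu, hv]
    cases A.out t1 <;> cases A.out t2 <;> cases A.out t3 <;> cases b <;> simp [majority]
  have hU : ∑ t, u t = A.outputProb g b := rfl
  have hV : ∑ t, v t = 1 - A.outputProb g b := by
    rw [← A.outputProb_add_outputProb_not g b, add_sub_cancel_left]
    rfl
  rw [hsum]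
  simp only [hterm, Finset.sum_add_distrib, ← Finset.mul_sum, ← Finset.sum_mul, hU, hV]
  ring

theorem le_outputProb_amplify3 (A : QueryAlg n M) {g : Fin n → Fin M} {b : Bool}
    (h : 2 / 3 ≤ A.outputProb g b) : 20 / 27 ≤ A.amplify3.outputProb g b := by
  have h1 := A.outputProb_le_one g b
  rw [outputProb_amplify3]
  nlinarith [mul_nonneg (sub_nonneg.2 h) (sub_nonneg.2 h1),
    mul_nonneg (mul_nonneg (sub_nonneg.2 h) (sub_nonneg.2 h1)) (sub_nonneg.2 h)]

/-! ### Simulating the oracle of a composition -/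

/-- The gate `U` on the registers of an algorithm for oracles `[n] → [M]`, performed inside a
computation with an additional value register in `[n]`. -/
def simulateUnitary {W : Type} [Fintype W] [DecidableEq W]
    (U : Matrix.unitaryGroup (Fin n × Fin M × W) ℂ) :
    Matrix.unitaryGroup (Fin n × Fin n × (Fin M × W)) ℂ :=
  ⟨Matrix.reindex (Equiv.prodAssoc (Fin n) (Fin M × W) (Fin n) |>.trans
      (Equiv.prodCongr (Equiv.refl _) (Equiv.prodComm _ _)))
      (Equiv.prodAssoc (Fin n) (Fin M × W) (Fin n) |>.trans
      (Equiv.prodCongr (Equiv.refl _) (Equiv.prodComm _ _)))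
      ((U : Matrix (Fin n × Fin M × W) (Fin n × Fin M × W) ℂ) ⊗ₖ
        (1 : Matrix (Fin n) (Fin n) ℂ)), by
    have h := Matrix.kronecker_mem_unitary U.2 (one_mem (Matrix.unitaryGroup (Fin n) ℂ))
    rw [Matrix.mem_unitaryGroup_iff, Matrix.star_eq_conjTranspose] at h ⊢
    rw [Matrix.conjTranspose_reindex, Matrix.reindex_apply, Matrix.reindex_apply,
      Matrix.submatrix_mul_equiv, h, Matrix.submatrix_one_equiv]⟩

/-- The permutation `(i, a, j, w) ↦ (i, -a, j - x (-a), w)` of the computational basis. As a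
gate it adds `x a` to the register `j` and then negates the register `a`. -/
def addComposedPerm [NeZero n] [NeZero M] {W : Type} (x : Fin n → Fin M) :
    Equiv.Perm (Fin n × Fin n × (Fin M × W)) where
  toFun k := (k.1, -k.2.1, k.2.2.1 - x (-k.2.1), k.2.2.2)
  invFun k := (k.1, -k.2.1, k.2.2.1 + x k.2.1, k.2.2.2)
  left_inv k := by simp
  right_inv k := by simp

/-- The gates that simulate one gate of an algorithm with the oracle of `x ∘ π`. A query is
replaced by two queries to `π`: the first computes `π i` in an additional register, the second
erases it again. -/
def simulateGate [NeZero n] [NeZero M] {W : Type} [Fintype W] [DecidableEq W]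
    (x : Fin n → Fin M) : QGate (Fin n × Fin M × W) → List (QGate (Fin n × Fin n × (Fin M × W)))
  | .unitary U => [.unitary (simulateUnitary U)]
  | .query => [.query, .unitary (permUnitary (addComposedPerm x)), .query]

/-- The state `ψ` together with the additional register in the state `0`. -/
def withZeroRegister [NeZero n] {W : Type} (ψ : Fin n × Fin M × W → ℂ)
    (k : Fin n × Fin n × (Fin M × W)) : ℂ :=
  if k.2.1 = 0 then ψ (k.1, k.2.2) else 0

theorem foldl_simulateGate [NeZero n] [NeZero M] {W : Type} [Fintype W] [DecidableEq W]
    (x : Fin n → Fin M) (π : Fin n → Fin n) (ψ : Fin n × Fin M × W → ℂ)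
    (G : QGate (Fin n × Fin M × W)) :
    (simulateGate x G).foldl (QGate.apply π) (withZeroRegister ψ) =
      withZeroRegister (QGate.apply (x ∘ π) ψ G) := by
  cases G with
  | unitary U =>
    funext k
    obtain ⟨i, a, jw⟩ := k
    rw [simulateGate, List.foldl_cons, List.foldl_nil, QGate.apply_unitary, QGate.apply_unitary]
    simp only [withZeroRegister, Matrix.mulVec, dotProduct, Fintype.sum_prod_type (α₁ := Fin n)]
    have hU : ∀ i' a' jw', (simulateUnitary U : Matrix (Fin n × Fin n × (Fin M × W))
        (Fin n × Fin n × (Fin M × W)) ℂ) (i, a, jw) (i', a', jw') =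
        (U : Matrix (Fin n × Fin M × W) (Fin n × Fin M × W) ℂ) (i, jw) (i', jw') * (if a = a' then 1 else 0) :=
      fun i' a' jw' => congrArg (fun t => (U : Matrix _ _ ℂ) (i, jw) (i', jw') * t)
        (Matrix.one_apply (i := a) (j := a'))
    simp only [hU]
    by_cases ha : a = 0
    · subst ha
      rw [if_pos rfl]
      refine Finset.sum_congr rfl fun i' _ => ?_
      rw [Finset.sum_eq_single 0]
      · simp
      · intro a' _ ha'
        simp [ha', Ne.symm ha']
      · simp
    · rw [if_neg ha]
      refine Finset.sum_eq_zero fun i' _ => Finset.sum_eq_zero fun a' _ =>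
        Finset.sum_eq_zero fun jw' _ => ?_
      by_cases ha' : a' = 0
      · subst ha'
        rw [if_neg ha, mul_zero, zero_mul]
      · simp [ha']
  | query =>
    funext k
    obtain ⟨i, a, j, w⟩ := k
    simp only [simulateGate, List.foldl_cons, List.foldl_nil, QGate.apply_query,
      QGate.apply_permUnitary, Function.comp_apply, withZeroRegister, addComposedPerm,
      Equiv.coe_fn_mk]
    by_cases ha : a = 0
    · subst ha
      simp
    · rw [if_neg ha, if_neg]
      intro h
      apply ha
      simpa using h

/-- An algorithm for oracles `[n] → [n]` that simulates `B` with the oracle of `x ∘ π`, given the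
oracle of `π`. -/
def simulate [NeZero n] [NeZero M] (B : QueryAlg n M) (x : Fin n → Fin M) : QueryAlg n n where
  Work := Fin M × B.Work
  init := (B.init.1, 0, B.init.2)
  gates := B.gates.flatMap (simulateGate x)
  out k := B.out (k.1, k.2.2)

theorem queries_simulate [NeZero n] [NeZero M] (B : QueryAlg n M) (x : Fin n → Fin M) :
    (B.simulate x).queries = 2 * B.queries := by
  have h : ∀ L : List (QGate B.Basis),
      (L.flatMap (simulateGate x)).countP QGate.isQuery = 2 * L.countP QGate.isQuery := fun L => by
    induction L with
    | nil => rfl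
    | cons G L ih =>
      rw [List.flatMap_cons, List.countP_append, ih, List.countP_cons]
      cases G <;> simp [simulateGate, QGate.isQuery, List.countP_cons]
      ring
  exact h B.gates

theorem outputProb_simulate [NeZero n] [NeZero M] (B : QueryAlg n M) (x : Fin n → Fin M)
    (π : Fin n → Fin n) (b : Bool) :
    (B.simulate x).outputProb π b = B.outputProb (x ∘ π) b := by
  have hfold : ∀ (L : List (QGate B.Basis)) (ψ : B.Basis → ℂ),
      (L.flatMap (simulateGate x)).foldl (QGate.apply π) (withZeroRegister ψ) =
        withZeroRegister (L.foldl (QGate.apply (x ∘ π)) ψ) := fun L => by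
    induction L with
    | nil => exact fun ψ => rfl
    | cons G L ih =>
      intro ψ
      rw [List.flatMap_cons, List.foldl_append, foldl_simulateGate, ih]
      rfl
  have hfinal : (B.simulate x).finalState π = withZeroRegister (B.finalState (x ∘ π)) := by
    have hinit : (Pi.single (B.init.1, 0, B.init.2) 1 :
        Fin n × Fin n × (Fin M × B.Work) → ℂ) = withZeroRegister (Pi.single B.init 1) := by
      funext k
      obtain ⟨i, a, jw⟩ := k
      have h1 : ((i, a, jw) : Fin n × Fin n × (Fin M × B.Work)) = (B.init.1, 0, B.init.2) ↔
          a = 0 ∧ (i, jw) = B.init := by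
        refine ⟨fun h => ⟨congrArg (fun t => t.2.1) h,
          Prod.ext (congrArg (fun t => t.1) h) (congrArg (fun t => t.2.2) h)⟩, ?_⟩
        rintro ⟨rfl, h⟩
        rw [← h]
      rw [Pi.single_apply, if_congr h1 rfl rfl, withZeroRegister, Pi.single_apply, ite_and]
    have hrun := hfold B.gates (Pi.single B.init 1)
    rw [← hinit] at hrun
    exact hrun
  rw [outputProb, hfinal, outputProb]
  change ∑ k : Fin n × Fin n × (Fin M × B.Work), (if B.out (k.1, k.2.2) = b then
    ‖withZeroRegister (B.finalState (x ∘ π)) k‖ ^ 2 else 0) = _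
  rw [Fintype.sum_prod_type, Fintype.sum_prod_type]
  refine Finset.sum_congr rfl fun i _ => ?_
  rw [Fintype.sum_prod_type, Finset.sum_eq_single 0]
  · simp [withZeroRegister]
  · intro a _ ha
    simp [withZeroRegister, ha]
  · simp

end QueryAlg

/-! ### Symmetric functions on small-range inputs -/

theorem proposition3 :
    (∃ Λ : ℝ, 0 < Λ ∧ IsSmallRangeConstant Λ) ∧
    ∀ Λ : ℝ, 0 < Λ → IsSmallRangeConstant Λ →
      ∀ (n M : ℕ) (S : Set (Fin n → Fin M)) (f : S → Bool), PermSymmetric f →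
      ∀ q r : ℕ, quantumQueryComplexity f = q → r = ⌈216 * (q : ℝ) ^ 3 * Λ ^ (-3 : ℤ)⌉₊ →
      1 ≤ r → r ≤ n →
      ∀ A : QueryAlg n M, A.queries = q → A.Computes f →
        A.amplify3.queries = 3 * q ∧
        (∀ x : S, 2 / 3 ≤
          smallRangeExpect n r (fun C => A.amplify3.outputProb ((x : Fin n → Fin M) ∘ C) (f x))) ∧
        ∀ (g : Fin n → Fin r) (h : Fin r ↪ Fin n),
          (Set.range (h ∘ g)).ncard ≤ r ∧
          ∀ x y : Fin n → Fin M, Set.EqOn x y (Set.range (h ∘ g)) → ∀ b : Bool,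
            A.amplify3.outputProb (x ∘ (h ∘ g)) b = A.amplify3.outputProb (y ∘ (h ∘ g)) b := by
  refine ⟨⟨1 / 12, by norm_num, isSmallRangeConstant_one_div_twelve⟩, ?_⟩
  intro Λ hΛ hsmall n M S f hf q r _ hr hr1 hrn A hAq hA
  refine ⟨by rw [A.queries_amplify3, hAq], fun x => ?_, fun g h => ⟨?_, fun x y hxy b => ?_⟩⟩
  · have : NeZero n := ⟨by omega⟩
    have : NeZero M := ⟨(A.init.2.1.pos).ne'⟩
    -- `6 q` queries suffice to run the amplified algorithm with the oracle of `x ∘ π`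
    have hqueries : ((A.amplify3.simulate (x : Fin n → Fin M)).queries : ℝ) ≤
        Λ * (r : ℝ) ^ (1 / 3 : ℝ) := by
      rw [QueryAlg.queries_simulate, A.queries_amplify3, hAq]
      have h1 : (6 * (q : ℝ) / Λ) ^ 3 ≤ r := by
        rw [hr]
        refine le_trans (le_of_eq ?_) (Nat.le_ceil _)
        rw [zpow_neg, show (3 : ℤ) = ((3 : ℕ) : ℤ) from rfl, zpow_natCast]
        field_simp
        ring
      have h2 : 6 * (q : ℝ) / Λ ≤ (r : ℝ) ^ (1 / 3 : ℝ) := by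
        calc 6 * (q : ℝ) / Λ = ((6 * (q : ℝ) / Λ) ^ 3) ^ (1 / 3 : ℝ) := by
              rw [← Real.rpow_natCast, ← Real.rpow_mul (by positivity)]
              norm_num
          _ ≤ _ := by gcongr
      rw [div_le_iff₀ hΛ] at h2
      push_cast
      linarith
    have hadv := hsmall n r hr1 hrn _ hqueries (f x)
    simp only [QueryAlg.outputProb_simulate] at hadv
    have hperm : 20 / 27 ≤ 𝔼 π : Equiv.Perm (Fin n),
        A.amplify3.outputProb ((x : Fin n → Fin M) ∘ π) (f x) := by
      refine Finset.le_expect Finset.univ_nonempty fun π _ => ?_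
      obtain ⟨hS, hfx⟩ := hf x π
      apply A.le_outputProb_amplify3
      rw [← hfx]
      exact hA ⟨_, hS⟩
    have := (abs_le.1 hadv).2
    linarith
  · calc (Set.range (h ∘ g)).ncard ≤ (Set.range h).ncard :=
          Set.ncard_le_ncard (Set.range_comp_subset_range g h) (Set.toFinite _)
      _ ≤ r := by
          rw [← Set.image_univ]
          exact (Set.ncard_image_le (Set.toFinite _)).trans (by simp)
  · rw [show x ∘ (h ∘ g) = y ∘ (h ∘ g) from funext fun i => hxy ⟨i, rfl⟩]
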